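/- **Discrete Korn inequality for space groups.** Let $E(d)$ be the group of isometries $g\cdot x=\mathrm{rot}(g)x+\mathrm{trans}(g)$ of $\mathbb R^d$, with $\mathrm{rot}(g)\in O(d)$ and $\mathrm{trans}(g)\in\mathbb R^d$. A *space group* in $E(d)$ is a subgroup all of whose orbits in $\mathbb R^d$ are discrete and which contains $d$ translations with linearly independent translation components. *Setting.* Let $d=d_1+d_2$, and let $\mathcal G<E(d)$ be a discrete group in normal form: every element of $\mathcal G$ is of the form $A\oplus s:(x,y)\mapsto(Ax,s\cdot y)$ with $A\in O(d_1)$, $s\in E(d_2)$, and the image $\mathcal S=\pi(\mathcal G)$ under $\pi(A\oplus s)=s$ is a space group in $E(d_2)$. Let $\mathcal T\subset\mathcal G$ be such that $\pi$ maps $\mathcal T$ bijectively onto the set of translations of $\mathcal S$. Put $\mathcal T^N=\{t^N: t\in\mathcal T\}$ and $M=\{N\ge1:\mathcal T^N\text{ is a normal subgroup of }\mathcal G\}$. A map $u:\mathcal G\to\mathbb R^d$ is $\mathcal T^N$-periodic if $u(gt)=u(g)$ for all $g\in\mathcal G$, $t\in\mathcal T^N$; $U_{\rm per}$ is the set of maps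 that are $\mathcal T^N$-periodic for some $N\in M$. For $N\in M$ let $\mathcal C_N$ be a representation set of $\mathcal G/\mathcal T^N$. Let $x_0\in\mathbb R^d$ be such that $g\mapsto g\cdot x_0$ is injective on $\mathcal G$. (A space group $\mathcal G$ has this form with $d_1=0$, $d_2=d$, $\mathcal S=\mathcal G$, $\mathcal T$ its subgroup of translations, and $M=\{1,2,\dots\}$.) *Seminorms.* Let $\mathcal R\subset\mathcal G$ be finite and equip $\{v:\mathcal R\to\mathbb R^d\}$ with the norm $\|v\|=(\sum_{h\in\mathcal R}\|v(h)\|^2)^{1/2}$. Let $U_{\rm trans}(\mathcal R)$ be the set of all $v$ for which there is $a\in\mathbb R^d$ with $\mathrm{rot}(h)v(h)=a$ for all $h\in\mathcal R$; let $U_{\rm rot}(\mathcal R)$ be the set of all $v$ for which there is $S\in\mathrm{Skew}(d)$ with $\mathrm{rot}(h)v(h)=S(h\cdot x_0-x_0)$ for all $h\in\mathcal R$; let $U_{\rm rot,0,0}(\mathcal R)$ be defined like $U_{\rm rot}(\mathcal R)$, but with $S$ restricted to the matrices $S'\oplus 0_{d_2,d_2}$, $S'\in\mathrm{Skew}(d_1)$.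 Put $U_{\rm iso}=U_{\rm trans}+U_{\rm rot}$ and $U_{\rm iso,0,0}=U_{\rm trans}+U_{\rm rot,0,0}$, and let $\pi_U$ be the orthogonal projection with kernel $U$. For $\mathcal T^N$-periodic $u$, $N\in M$, set $$\|u\|_{\mathcal R}=\Big(\tfrac1{|\mathcal C_N|}\sum_{g\in\mathcal C_N}\|\pi_{U_{\rm iso}(\mathcal R)}(u(g\,\cdot)|_{\mathcal R})\|^2\Big)^{1/2},\qquad \|u\|_{\mathcal R,0,0}=\Big(\tfrac1{|\mathcal C_N|}\sum_{g\in\mathcal C_N}\|\pi_{U_{\rm iso,0,0}(\mathcal R)}(u(g\,\cdot)|_{\mathcal R})\|^2\Big)^{1/2},$$ $$\|\nabla_{\mathcal R}u\|_2=\Big(\tfrac1{|\mathcal C_N|}\sum_{g\in\mathcal C_N}\sum_{h\in\mathcal R}\|u(gh)-\mathrm{rot}(h)^Tu(g)\|^2\Big)^{1/2}.$$ *Property 2.* A finite set $\mathcal R''\subset\mathcal G$ has Property 1 if $\mathrm{id}\in\mathcal R''$ and $\mathrm{aff}(\mathcal R''\cdot x_0)=\mathrm{aff}(\mathcal G\cdot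 x_0)$. A finite set $\mathcal R\subset\mathcal G$ has Property 2 if there are $\mathcal R',\mathcal R''\subset\mathcal G$ such that $\mathrm{id}\in\mathcal R'$, $\mathcal R'$ generates $\mathcal G$, $\mathcal R''$ has Property 1 and $\mathcal R'\mathcal R''\subset\mathcal R$. *Claim.* If $\mathcal G$ is a space group in $E(d)$ and $\mathcal R\subset\mathcal G$ has Property 2, then the seminorms $\|\cdot\|_{\mathcal R}$, $\|\cdot\|_{\mathcal R,0,0}$ and $\|\nabla_{\mathcal R}\,\cdot\|_2$ on $U_{\rm per}$ are pairwise equivalent: there are constants $c,K>0$, independent of $N\in M$, of $\mathcal C_N$ and of $u$, such that for every $N\in M$ and every $\mathcal T^N$-periodic $u:\mathcal G\to\mathbb R^d$ $$c\|u\|_{\mathcal R,0,0}\le\|u\|_{\mathcal R}\le K\|u\|_{\mathcal R,0,0},\qquad c\|\nabla_{\mathcal R}u\|_2\le\|u\|_{\mathcal R}\le K\|\nabla_{\mathcal R}u\|_2,\qquad c\|\nabla_{\mathcal R}u\|_2\le\|u\|_{\mathcal R,0,0}\le K\|\nabla_{\mathcal R}u\|_2 .$$ -/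

import Mathlib

open scoped Pointwise

noncomputable section

namespace DiscreteKorn

/-- The Euclidean space `ℝ^d`, written as column vectors. -/
abbrev Vec (d : ℕ) : Type := EuclideanSpace ℝ (Fin d)

/-- The Euclidean group `E(d)`: all isometries `x ↦ A x + b` of `ℝ^d` onto itself, with composition
as multiplication. -/
abbrev Euc (d : ℕ) : Type := Vec d ≃ᵃⁱ[ℝ] Vec d

/-- The linear component `A ∈ O(d)` of `x ↦ A x + b`. -/
def rot {d : ℕ} (g : Euc d) : Vec d ≃ₗᵢ[ℝ] Vec d := g.linearIsometryEquiv

/-- The translation component `b` of `x ↦ A x + b`. -/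
def transl {d : ℕ} (g : Euc d) : Vec d := g 0

/-- An isometry is a translation if its linear component is the identity. -/
def IsTranslation {d : ℕ} (g : Euc d) : Prop := rot g = 1

/-- A subgroup of `E(d)` is discrete if every orbit in `ℝ^d` is a discrete set. -/
def IsDiscreteGroup {d : ℕ} (G : Subgroup (Euc d)) : Prop :=
  ∀ x : Vec d, IsDiscrete (Set.range fun g : G => (g : Euc d) x)

/-- A `d`-dimensional space group: a discrete subgroup of `E(d)` that contains `d` translations with
linearly independent translation components. -/
structure IsSpaceGroup {d : ℕ} (G : Subgroup (Euc d)) : Prop where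
  discrete : IsDiscreteGroup G
  translations : ∃ t : Fin d → Euc d,
    (∀ i, t i ∈ G ∧ IsTranslation (t i)) ∧ LinearIndependent ℝ fun i => transl (t i)

section Decomposition

variable {d d₁ d₂ : ℕ} (hd : d₁ + d₂ = d)

/-- The vector `(x, y) ∈ ℝ^d` built from `x ∈ ℝ^{d₁}` and `y ∈ ℝ^{d₂}`, where `d = d₁ + d₂`. -/
def blockVec (x : Vec d₁) (y : Vec d₂) : Vec d :=
  WithLp.toLp 2 fun i => Fin.append x y (Fin.cast hd.symm i)

/-- The direct sum `A ⊕ B` of two square matrices, with rows and columns in `{1, …, d₁ + d₂}`. -/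
def matrixSum (A : Matrix (Fin d₁) (Fin d₁) ℝ) (B : Matrix (Fin d₂) (Fin d₂) ℝ) :
    Matrix (Fin d) (Fin d) ℝ :=
  (Matrix.fromBlocks A 0 0 B).reindex (finSumFinEquiv.trans (finCongr hd))
    (finSumFinEquiv.trans (finCongr hd))

/-- `g = A ⊕ s`: the isometry `g` of `ℝ^d` is `(x, y) ↦ (A x, s y)`. -/
def IsDirectSum (A : Vec d₁ ≃ₗᵢ[ℝ] Vec d₁) (s : Euc d₂) (g : Euc d) : Prop :=
  ∀ x y, g (blockVec hd x y) = blockVec hd (A x) (s y)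

/-- `g ∈ O(d₁) ⊕ E(d₂)` and `π(g) = s`, where `π (A ⊕ s) = s`. -/
def ProjectsTo (g : Euc d) (s : Euc d₂) : Prop :=
  ∃ A : Vec d₁ ≃ₗᵢ[ℝ] Vec d₁, IsDirectSum hd A s g

/-- The normal form of a discrete group `G < E(d)`: there is a splitting `d = d₁ + d₂` such that
`G < O(d₁) ⊕ S` for a `d₂`-dimensional space group `S` with `π(G) = S`. -/
structure IsNormalForm (G : Subgroup (Euc d)) (S : Subgroup (Euc d₂)) : Prop where
  discrete : IsDiscreteGroup G
  spaceGroup : IsSpaceGroup S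
  mapsTo : ∀ g ∈ G, ∃ s ∈ S, ProjectsTo hd g s
  surjective : ∀ s ∈ S, ∃ g ∈ G, ProjectsTo hd g s

/-- `T ⊆ G` is a section of the translation group `T_S` of `S`: the projection `π` restricts to a
bijection from `T` onto the set of translations in `S`. -/
structure IsTranslationSection (G : Subgroup (Euc d)) (S : Subgroup (Euc d₂)) (T : Set G) :
    Prop where
  mapsTo : ∀ t ∈ T, ∃ s ∈ S, IsTranslation s ∧ ProjectsTo hd (t : Euc d) s
  bijective : ∀ s ∈ S, IsTranslation s → ∃! t : G, t ∈ T ∧ ProjectsTo hd (t : Euc d) s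

end Decomposition

section Periodicity

variable {Γ : Type*} [Group Γ]

/-- The set `T^N = {t^N | t ∈ T}`. -/
def powSet (T : Set Γ) (N : ℕ) : Set Γ := (fun t => t ^ N) '' T

/-- The set `M` of all integers `N ≥ 1` for which `T^N` is a normal subgroup. -/
def admissiblePeriods (T : Set Γ) : Set ℕ :=
  {N | 1 ≤ N ∧ ∃ H : Subgroup Γ, H.Normal ∧ (H : Set Γ) = powSet T N}

/-- `u` is `T^N`-periodic. -/
def IsPeriodic {X : Type*} (T : Set Γ) (N : ℕ) (u : Γ → X) : Prop :=
  ∀ g, ∀ t ∈ powSet T N, u (g * t) = u g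

/-- `C` is a representation set of `Γ / T^N`: it contains exactly one element of each coset
`g T^N`. -/
def IsRepresentationSet (T : Set Γ) (N : ℕ) (C : Finset Γ) : Prop :=
  ∀ g, ∃! c, c ∈ C ∧ ∃ t ∈ powSet T N, g = c * t

/-- The quadratic mean `(|C|⁻¹ ∑_{g ∈ C} ‖w g‖²)^{1/2}`. If `w` is `T^N`-periodic and `C` is a
representation set of `Γ / T^N`, this is the norm `‖w‖₂`. -/
def meanNorm {V : Type*} [Norm V] (C : Finset Γ) (w : Γ → V) : ℝ :=
  Real.sqrt ((1 / (C.card : ℝ)) * ∑ g ∈ C, ‖w g‖ ^ 2)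

end Periodicity

/-- `Skew(n)`: the real `n × n` matrices `S` with `Sᵀ = -S`. -/
def skew (n : ℕ) : Submodule ℝ (Matrix (Fin n) (Fin n) ℝ) where
  carrier := {S | S.transpose = -S}
  add_mem' {A B} hA hB := by
    simp only [Set.mem_ofPred_eq] at hA hB ⊢
    rw [Matrix.transpose_add, hA, hB, neg_add]
  zero_mem' := by simp
  smul_mem' c A hA := by
    simp only [Set.mem_ofPred_eq] at hA ⊢
    rw [Matrix.transpose_smul, hA, smul_neg]

/-- The matrices `S ⊕ 0_{d₂,d₂}` with `S ∈ Skew(d₁)`. -/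
def skewZero {d d₁ d₂ : ℕ} (hd : d₁ + d₂ = d) : Submodule ℝ (Matrix (Fin d) (Fin d) ℝ) where
  carrier := {B | ∃ S ∈ skew d₁, B = matrixSum hd S 0}
  add_mem' := by
    rintro _ _ ⟨S, hS, rfl⟩ ⟨S', hS', rfl⟩
    refine ⟨S + S', add_mem hS hS', ?_⟩
    simp only [matrixSum, Matrix.reindex_apply]
    rw [← add_zero (0 : Matrix (Fin d₂) (Fin d₂) ℝ), ← add_zero (0 : Matrix (Fin d₁) (Fin d₂) ℝ),
      ← add_zero (0 : Matrix (Fin d₂) (Fin d₁) ℝ), ← Matrix.fromBlocks_add]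
    simp only [add_zero]
    rfl
  zero_mem' := ⟨0, zero_mem _, by
    simp only [matrixSum, Matrix.reindex_apply, Matrix.fromBlocks_zero]
    rfl⟩
  smul_mem' := by
    rintro c _ ⟨S, hS, rfl⟩
    refine ⟨c • S, Submodule.smul_mem _ c hS, ?_⟩
    simp only [matrixSum, Matrix.reindex_apply]
    rw [← smul_zero (A := Matrix (Fin d₂) (Fin d₂) ℝ) c,
      ← smul_zero (A := Matrix (Fin d₁) (Fin d₂) ℝ) c,
      ← smul_zero (A := Matrix (Fin d₂) (Fin d₁) ℝ) c, ← Matrix.fromBlocks_smul]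
    simp only [smul_zero]
    rfl

section Seminorms

variable {d : ℕ} {G : Subgroup (Euc d)}

/-- The space of all maps `u : R → ℝ^d`, with the norm `(∑_{g ∈ R} ‖u g‖²)^{1/2}`. -/
abbrev Disp (R : Finset G) : Type := PiLp 2 fun _ : R => Vec d

/-- `U_trans(R)`: there is `a ∈ ℝ^d` with `rot(g) u(g) = a` for all `g ∈ R`. -/
def Utrans (R : Finset G) : Submodule ℝ (Disp R) where
  carrier := {u | ∃ a : Vec d, ∀ g : R, rot (g.1 : Euc d) (u g) = a}
  add_mem' := by
    rintro u v ⟨a, ha⟩ ⟨b, hb⟩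
    exact ⟨a + b, fun g => by simp [ha g, hb g]⟩
  zero_mem' := ⟨0, fun g => by simp⟩
  smul_mem' := by
    rintro c u ⟨a, ha⟩
    exact ⟨c • a, fun g => by simp [ha g]⟩

/-- For a space `W` of matrices: there is `S ∈ W` with `rot(g) u(g) = S (g · x₀ - x₀)` for all
`g ∈ R`. -/
def UrotOf (W : Submodule ℝ (Matrix (Fin d) (Fin d) ℝ)) (x₀ : Vec d) (R : Finset G) :
    Submodule ℝ (Disp R) where
  carrier := {u | ∃ S ∈ W, ∀ g : R,
    rot (g.1 : Euc d) (u g) = Matrix.toEuclideanLin S ((g.1 : Euc d) x₀ - x₀)}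
  add_mem' := by
    rintro u v ⟨a, hW, ha⟩ ⟨b, hW', hb⟩
    exact ⟨a + b, add_mem hW hW', fun g => by
      rw [PiLp.add_apply, map_add, map_add, LinearMap.add_apply, ha g, hb g]⟩
  zero_mem' := ⟨0, zero_mem _, fun g => by
    rw [PiLp.zero_apply, map_zero, map_zero, LinearMap.zero_apply]⟩
  smul_mem' := by
    rintro c u ⟨a, hW, ha⟩
    exact ⟨c • a, Submodule.smul_mem _ c hW, fun g => by
      rw [PiLp.smul_apply, map_smul, map_smul, LinearMap.smul_apply, ha g]⟩

/-- `U_rot(R)`: infinitesimal rotations, generated by `S ∈ Skew(d)`. -/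
def Urot (x₀ : Vec d) (R : Finset G) : Submodule ℝ (Disp R) := UrotOf (skew d) x₀ R

/-- `U_iso(R) = U_trans(R) + U_rot(R)`. -/
def Uiso (x₀ : Vec d) (R : Finset G) : Submodule ℝ (Disp R) := Utrans R ⊔ Urot x₀ R

/-- `U_{rot,0,0}(R)`: infinitesimal rotations about `{0} × ℝ^{d₂}`, generated by `S ⊕ 0` with
`S ∈ Skew(d₁)`. -/
def Urot00 {d₁ d₂ : ℕ} (hd : d₁ + d₂ = d) (x₀ : Vec d) (R : Finset G) : Submodule ℝ (Disp R) :=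
  UrotOf (skewZero hd) x₀ R

/-- `U_{iso,0,0}(R) = U_trans(R) + U_{rot,0,0}(R)`. -/
def Uiso00 {d₁ d₂ : ℕ} (hd : d₁ + d₂ = d) (x₀ : Vec d) (R : Finset G) : Submodule ℝ (Disp R) :=
  Utrans R ⊔ Urot00 hd x₀ R

/-- The orthogonal projection of `{v : R → ℝ^d}` with kernel `U`. -/
def projKer {R : Finset G} (U : Submodule ℝ (Disp R)) (v : Disp R) : Disp R :=
  Uᗮ.starProjection v

/-- The patch `u(g ·)|_R`, i.e. `h ↦ u(g h)`. -/
def patch (R : Finset G) (u : G → Vec d) (g : G) : Disp R :=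
  WithLp.toLp 2 fun h => u (g * h.1)

/-- The discrete derivative `∇_R u (g) : h ↦ u(g h) - rot(h)ᵀ u(g)`. -/
def nabla (R : Finset G) (u : G → Vec d) (g : G) : Disp R :=
  WithLp.toLp 2 fun h => u (g * h.1) - (rot (h.1 : Euc d)).symm (u g)

/-- `‖u‖_R`, computed with a representation set `C` of `G / T^N` for a `T^N`-periodic `u`. -/
def rigidNorm (x₀ : Vec d) (R C : Finset G) (u : G → Vec d) : ℝ :=
  meanNorm C fun g => projKer (Uiso x₀ R) (patch R u g)

/-- `‖u‖_{R,0,0}`, computed with a representation set `C` of `G / T^N` for a `T^N`-periodic `u`. -/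
def rigidNorm00 {d₁ d₂ : ℕ} (hd : d₁ + d₂ = d) (x₀ : Vec d) (R C : Finset G) (u : G → Vec d) : ℝ :=
  meanNorm C fun g => projKer (Uiso00 hd x₀ R) (patch R u g)

/-- `‖∇_R u‖₂`, computed with a representation set `C` of `G / T^N` for a `T^N`-periodic `u`. -/
def gradNorm (R C : Finset G) (u : G → Vec d) : ℝ :=
  meanNorm C (nabla R u)

/-- Property 1 of a finite set `R`: `id ∈ R` and `aff(R · x₀) = aff(G · x₀)`. -/
structure Property1 (x₀ : Vec d) (R : Finset G) : Prop where
  id_mem : 1 ∈ R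
  aff_eq : affineSpan ℝ ((fun g : G => (g : Euc d) x₀) '' (R : Set G)) =
    affineSpan ℝ (Set.range fun g : G => (g : Euc d) x₀)

/-- Property 2 of a finite set `R`: `R' R'' ⊆ R` for some `R'` that contains the identity and
generates `G` and some `R''` with Property 1. -/
def Property2 (x₀ : Vec d) (R : Finset G) : Prop :=
  ∃ (R' : Set G) (R'' : Finset G), 1 ∈ R' ∧ Subgroup.closure R' = ⊤ ∧ Property1 x₀ R'' ∧
    R' * (R'' : Set G) ⊆ (R : Set G)

end Seminorms

end DiscreteKorn

end

/-!
In the fixed frame, `f g = rot(g) u(g)`, the patch seminorm at `g` measures how far `u` is near `g`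
from an infinitesimal rigid motion: there is a skew map `S g` with
`f (g h) - f g ≈ S g (g h · x₀ - g · x₀)` for all `h ∈ R`. Property 2 forces `S` to vary slowly
along a generating set, and the cocycle identity for the error then extends the approximation from
`h ∈ R` to every `h ∈ G`. A translation `t ∈ G` satisfies `t g = g (g⁻¹ t g)` with only finitely
many conjugates `g⁻¹ t g`, whence `f (t g) - f g ≈ S g b` with `b` the translation vector of `t`.
As `S g` is skew, the symmetric part of these differences of `f` is small. Translations commute, so
summation by parts over the finite group `G / T^N` bounds the differences of `f` in mean square by
their symmetric part. This bounds `S`, and with it the discrete derivative of `u`.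
-/

namespace DiscreteKorn

open Subgroup (IsComplement)
open scoped RealInnerProductSpace

section Cosets

variable {Γ X : Type*} [Group Γ] {H : Subgroup Γ} {C C' : Finset Γ}

/-- `φ` is invariant under right multiplication by `H`, so that it is a function on `Γ ⧸ H`. For
`H = T^N` this is `T^N`-periodicity. -/
def PeriodicMod (H : Subgroup Γ) (φ : Γ → X) : Prop :=
  ∀ g, ∀ t ∈ H, φ (g * t) = φ g

theorem PeriodicMod.comp {Y : Type*} {φ : Γ → X} (hφ : PeriodicMod H φ) (F : X → Y) :
    PeriodicMod H fun g => F (φ g) :=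
  fun g t ht => congrArg F (hφ g t ht)

theorem PeriodicMod.exists_lift {φ : Γ → X} (hφ : PeriodicMod H φ) :
    ∃ ψ : Γ ⧸ H → X, ∀ g : Γ, ψ g = φ g :=
  ⟨Quotient.lift φ fun a b hab => by
    simpa using (hφ a _ (QuotientGroup.leftRel_apply.mp hab)).symm, fun _ => rfl⟩

theorem sum_isComplement_eq_sum_quotient [Fintype (Γ ⧸ H)]
    (hC : IsComplement (C : Set Γ) (H : Set Γ)) {A : Type*} [AddCommMonoid A] (ψ : Γ ⧸ H → A) :
    ∑ c ∈ C, ψ c = ∑ q, ψ q := by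
  rw [← Finset.sum_coe_sort C fun c => ψ c]
  exact (Subgroup.isComplement_subgroup_right_iff_bijective.mp hC).sum_comp ψ

theorem finiteIndex_of_isComplement_finset (hC : IsComplement (C : Set Γ) (H : Set Γ)) :
    H.FiniteIndex :=
  hC.finite_left_iff.mp C.finite_toSet

theorem PeriodicMod.sum_isComplement_eq {A : Type*} [AddCommMonoid A] {φ : Γ → A}
    (hφ : PeriodicMod H φ) (hC : IsComplement (C : Set Γ) (H : Set Γ))
    (hC' : IsComplement (C' : Set Γ) (H : Set Γ)) : ∑ c ∈ C, φ c = ∑ c ∈ C', φ c := by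
  have := finiteIndex_of_isComplement_finset hC
  have := Fintype.ofFinite (Γ ⧸ H)
  obtain ⟨ψ, hψ⟩ := hφ.exists_lift
  simp only [← hψ, sum_isComplement_eq_sum_quotient hC, sum_isComplement_eq_sum_quotient hC']

theorem isComplement_map_mulRight [H.Normal] (hC : IsComplement (C : Set Γ) (H : Set Γ)) (w : Γ) :
    IsComplement (C.map (mulRightEmbedding w) : Set Γ) (H : Set Γ) := by
  rw [Subgroup.isComplement_subgroup_right_iff_existsUnique_quotientGroupMk] at hC ⊢
  intro q
  obtain ⟨c, hc, huniq⟩ := hC (q * (w : Γ ⧸ H)⁻¹)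
  refine ⟨⟨c * w, by simp⟩, ?_, ?_⟩
  · simp [hc]
  · rintro ⟨_, hx⟩ hxq
    obtain ⟨c', hc', rfl⟩ := Finset.mem_map.mp (Finset.mem_coe.mp hx)
    have : (⟨c', hc'⟩ : (C : Set Γ)) = c := huniq _ (by simp [← hxq])
    simp [← this]

theorem finite_range_conj_of_le_centralizer [H.FiniteIndex] {t : Γ}
    (ht : H ≤ Subgroup.centralizer {t}) : (Set.range fun g => g⁻¹ * t * g).Finite := by
  have hconj : PeriodicMod H fun g => g * t * g⁻¹ := fun g s hs => by
    have hst : s * t = t * s := Subgroup.mem_centralizer_singleton_iff.mp (ht hs)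
    calc g * s * t * (g * s)⁻¹ = g * (s * t) * s⁻¹ * g⁻¹ := by group
      _ = g * t * g⁻¹ := by rw [hst]; group
  obtain ⟨ψ, hψ⟩ := hconj.exists_lift
  refine (Set.finite_range ψ).subset ?_
  rintro _ ⟨g, rfl⟩
  exact ⟨(g⁻¹ : Γ), by simp [hψ]⟩

end Cosets

section L2Domination

variable {ι κ Γ E V W : Type*} [Group Γ] [NormedAddCommGroup E] [NormedAddCommGroup V]
  [NormedAddCommGroup W] {H : ι → Subgroup Γ} {e : ι → Γ → E}

/-- The sum of `‖φ i‖ ^ 2` over a representation set of `Γ ⧸ H i` is at most a constant times that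
of `‖e i‖ ^ 2`, uniformly in `i` and in the representation set. As `φ i` need not be periodic, its
sum may depend on the representation set. -/
def L2Dominated (H : ι → Subgroup Γ) (e : ι → Γ → E) (φ : ι → Γ → V) : Prop :=
  ∃ K : ℝ, 0 ≤ K ∧ ∀ i (C : Finset Γ), IsComplement (C : Set Γ) (H i : Set Γ) →
    ∑ c ∈ C, ‖φ i c‖ ^ 2 ≤ K * ∑ c ∈ C, ‖e i c‖ ^ 2

namespace L2Dominated

variable {φ ψ : ι → Γ → V}

theorem refl (H : ι → Subgroup Γ) (e : ι → Γ → E) : L2Dominated H e e :=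
  ⟨1, zero_le_one, fun _ _ _ => (one_mul _).ge⟩

theorem zero (H : ι → Subgroup Γ) (e : ι → Γ → E) : L2Dominated H e fun _ _ => (0 : V) :=
  ⟨0, le_rfl, fun i C _ => by simp⟩

theorem of_norm_le {ψ : ι → Γ → W} (hψ : L2Dominated H e ψ) {c : ℝ}
    (h : ∀ i g, ‖φ i g‖ ≤ c * ‖ψ i g‖) : L2Dominated H e φ := by
  obtain ⟨K, hK, hsum⟩ := hψ
  refine ⟨c ^ 2 * K, by positivity, fun i C hC => ?_⟩
  calc ∑ g ∈ C, ‖φ i g‖ ^ 2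
      ≤ ∑ g ∈ C, (c * ‖ψ i g‖) ^ 2 := by gcongr with g; exact h i g
    _ = c ^ 2 * ∑ g ∈ C, ‖ψ i g‖ ^ 2 := by simp only [mul_pow, Finset.mul_sum]
    _ ≤ c ^ 2 * K * ∑ g ∈ C, ‖e i g‖ ^ 2 := by
        rw [mul_assoc]; exact mul_le_mul_of_nonneg_left (hsum i C hC) (sq_nonneg c)

theorem norm (hφ : L2Dominated H e φ) : L2Dominated H e fun i g => ‖φ i g‖ :=
  hφ.of_norm_le fun i g => by rw [norm_norm, one_mul]

theorem neg (hφ : L2Dominated H e φ) : L2Dominated H e fun i g => -φ i g :=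
  hφ.of_norm_le fun i g => by rw [norm_neg, one_mul]

theorem add (hφ : L2Dominated H e φ) (hψ : L2Dominated H e ψ) :
    L2Dominated H e fun i g => φ i g + ψ i g := by
  obtain ⟨K₁, hK₁, h₁⟩ := hφ
  obtain ⟨K₂, hK₂, h₂⟩ := hψ
  refine ⟨2 * (K₁ + K₂), by positivity, fun i C hC => ?_⟩
  calc ∑ g ∈ C, ‖φ i g + ψ i g‖ ^ 2
      ≤ ∑ g ∈ C, 2 * (‖φ i g‖ ^ 2 + ‖ψ i g‖ ^ 2) := by
        gcongr with g
        exact (pow_le_pow_left₀ (norm_nonneg _) (norm_add_le _ _) 2).trans add_sq_le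
    _ = 2 * (∑ g ∈ C, ‖φ i g‖ ^ 2 + ∑ g ∈ C, ‖ψ i g‖ ^ 2) := by
        rw [← Finset.mul_sum, Finset.sum_add_distrib]
    _ ≤ 2 * (K₁ + K₂) * ∑ g ∈ C, ‖e i g‖ ^ 2 := by linarith [h₁ i C hC, h₂ i C hC]

theorem sub (hφ : L2Dominated H e φ) (hψ : L2Dominated H e ψ) :
    L2Dominated H e fun i g => φ i g - ψ i g := by
  simpa only [sub_eq_add_neg] using hφ.add hψ.neg

theorem sum (A : Finset κ) {φ : κ → ι → Γ → V} (h : ∀ a ∈ A, L2Dominated H e (φ a)) :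
    L2Dominated H e fun i g => ∑ a ∈ A, φ a i g := by
  induction A using Finset.cons_induction with
  | empty => simpa only [Finset.sum_empty] using zero H e
  | cons a A ha ih =>
    simp only [Finset.sum_cons]
    exact (h a (Finset.mem_cons_self a A)).add
      (ih fun b hb => h b (Finset.mem_cons_of_mem hb))

theorem shift (hφ : L2Dominated H e φ) (hH : ∀ i, (H i).Normal)
    (he : ∀ i, PeriodicMod (H i) (e i)) (w : Γ) : L2Dominated H e fun i g => φ i (g * w) := by
  obtain ⟨K, hK, hsum⟩ := hφ
  refine ⟨K, hK, fun i C hC => ?_⟩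
  have := hH i
  have hCw := isComplement_map_mulRight hC w
  calc ∑ g ∈ C, ‖φ i (g * w)‖ ^ 2
      = ∑ g ∈ C.map (mulRightEmbedding w), ‖φ i g‖ ^ 2 := by
        simp only [Finset.sum_map, mulRightEmbedding_apply]
    _ ≤ K * ∑ g ∈ C.map (mulRightEmbedding w), ‖e i g‖ ^ 2 := hsum i _ hCw
    _ = K * ∑ g ∈ C, ‖e i g‖ ^ 2 := by
        rw [((he i).comp fun x => ‖x‖ ^ 2).sum_isComplement_eq hCw hC]

theorem apply [NormedSpace ℝ V] [NormedSpace ℝ W] {A : ι → Γ → V →L[ℝ] W}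
    (hA : L2Dominated H e A) {x : ι → Γ → V} {c : ℝ} (hx : ∀ i g, ‖x i g‖ ≤ c) :
    L2Dominated H e fun i g => A i g (x i g) :=
  hA.of_norm_le (c := c) fun i g => by
    rw [mul_comm]; exact (A i g).le_of_opNorm_le_of_le le_rfl (hx i g)

theorem of_forall_exists_eq {A : Set κ} (hA : A.Finite) {ψ : κ → ι → Γ → V}
    (h : ∀ a ∈ A, L2Dominated H e (ψ a)) (hφ : ∀ i g, ∃ a ∈ A, φ i g = ψ a i g) :
    L2Dominated H e φ := by
  refine (sum hA.toFinset fun a ha => (h a (hA.mem_toFinset.mp ha)).norm).of_norm_le (c := 1)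
    fun i g => ?_
  obtain ⟨a, ha, hag⟩ := hφ i g
  rw [one_mul, hag]
  exact (Finset.single_le_sum (f := fun a => ‖ψ a i g‖) (fun _ _ => norm_nonneg _)
    (hA.mem_toFinset.mpr ha)).trans (le_abs_self _)

theorem of_exists_finiteIndex (h : (∃ i, (H i).FiniteIndex) → L2Dominated H e φ) :
    L2Dominated H e φ := by
  by_cases hfin : ∃ i, (H i).FiniteIndex
  · exact h hfin
  · exact ⟨0, le_rfl, fun i C hC => (hfin ⟨i, finiteIndex_of_isComplement_finset hC⟩).elim⟩

end L2Dominated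

theorem exists_norm_le_mul_sum_norm [NormedSpace ℝ V] [FiniteDimensional ℝ V] [NormedSpace ℝ W]
    [Fintype κ] (L : κ → V →L[ℝ] W) (hL : ∀ x, (∀ k, L k x = 0) → x = 0) :
    ∃ K : ℝ, ∀ x, ‖x‖ ≤ K * ∑ k, ‖L k x‖ := by
  let Λ : V →L[ℝ] κ → W := ContinuousLinearMap.pi L
  have hΛ : LinearMap.ker Λ.toLinearMap = ⊥ :=
    LinearMap.ker_eq_bot'.mpr fun x hx => hL x fun k => congrFun hx k
  obtain ⟨K, -, hK⟩ := Λ.toLinearMap.exists_antilipschitzWith hΛ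
  refine ⟨K, fun x => (hK.le_mul_norm (map_zero _) x).trans ?_⟩
  gcongr
  exact (pi_norm_le_iff_of_nonneg (by positivity)).mpr fun k =>
    Finset.single_le_sum (f := fun k => ‖L k x‖) (fun _ _ => norm_nonneg _) (Finset.mem_univ k)

namespace L2Dominated

variable [NormedSpace ℝ V] [FiniteDimensional ℝ V] [NormedSpace ℝ W]

theorem of_separating [Finite κ] (L : κ → V →L[ℝ] W) (hL : ∀ x, (∀ k, L k x = 0) → x = 0)
    {φ : ι → Γ → V} (h : ∀ k, L2Dominated H e fun i g => L k (φ i g)) : L2Dominated H e φ := by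
  have := Fintype.ofFinite κ
  obtain ⟨K, hK⟩ := exists_norm_le_mul_sum_norm L hL
  refine (sum Finset.univ fun k _ => (h k).norm).of_norm_le (c := K) fun i g => ?_
  rw [Real.norm_of_nonneg (by positivity)]
  exact hK _

theorem of_apply_spanning [FiniteDimensional ℝ W] [Finite κ] {b : κ → V}
    (hb : Submodule.span ℝ (Set.range b) = ⊤) {φ : ι → Γ → V →L[ℝ] W}
    (h : ∀ k, L2Dominated H e fun i g => φ i g (b k)) : L2Dominated H e φ :=
  of_separating (fun k => ContinuousLinearMap.apply ℝ W (b k))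
    (fun _ hA => ContinuousLinearMap.coe_injective (LinearMap.ext_on_range hb hA)) h

theorem of_inner_spanning {V : Type*} [NormedAddCommGroup V] [InnerProductSpace ℝ V]
    [FiniteDimensional ℝ V] [Finite κ] {b : κ → V} (hb : Submodule.span ℝ (Set.range b) = ⊤)
    {φ : ι → Γ → V} (h : ∀ k, L2Dominated H e fun i g => ⟪b k, φ i g⟫) : L2Dominated H e φ :=
  of_separating (fun k => innerSL ℝ (b k)) (fun x hx => by
    have hx0 : (innerSL ℝ x).toLinearMap = 0 :=
      LinearMap.ext_on_range hb fun k => (real_inner_comm _ _).trans (hx k)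
    exact inner_self_eq_zero.mp (LinearMap.congr_fun hx0 x)) h

end L2Dominated

end L2Domination

section DiscreteDerivatives

variable {κ Q A : Type*} [Fintype Q] [CommRing A] {τ : κ → Equiv.Perm Q}

theorem sum_difference_mul_difference {j k : κ} (hτ : Commute (τ j) (τ k)) (f : κ → Q → A) :
    ∑ q, (f j (τ k q) - f j q) * (f k (τ j q) - f k q) =
      ∑ q, (f j ((τ j).symm q) - f j q) * (f k ((τ k).symm q) - f k q) := by
  have h₁ : ∑ q, f j ((τ j).symm q) * f k ((τ k).symm q) = ∑ q, f j (τ k q) * f k (τ j q) := by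
    rw [← Equiv.sum_comp (τ j * τ k)]
    refine Finset.sum_congr rfl fun q _ => ?_
    rw [hτ.eq]
    nth_rw 1 [← hτ.eq]
    simp only [Equiv.Perm.coe_mul, Function.comp_apply, Equiv.symm_apply_apply]
  have h₂ : ∑ q, f j ((τ j).symm q) * f k q = ∑ q, f j q * f k (τ j q) := by
    rw [← Equiv.sum_comp (τ j)]; simp only [Equiv.symm_apply_apply]
  have h₃ : ∑ q, f j q * f k ((τ k).symm q) = ∑ q, f j (τ k q) * f k q := by
    rw [← Equiv.sum_comp (τ k)]; simp only [Equiv.symm_apply_apply]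
  simp only [sub_mul, mul_sub, Finset.sum_sub_distrib]
  rw [h₁, h₂, h₃]
  ring

variable [Fintype κ]

/-- The sum on the right is the square of the discrete divergence. -/
theorem sum_difference_mul_difference_eq_sum_sq (hτ : ∀ j k, Commute (τ j) (τ k)) (f : κ → Q → A) :
    ∑ j, ∑ k, ∑ q, (f j (τ k q) - f j q) * (f k (τ j q) - f k q) =
      ∑ q, (∑ j, (f j ((τ j).symm q) - f j q)) ^ 2 := by
  simp only [fun j k => sum_difference_mul_difference (hτ j k) f, sq, Finset.sum_mul_sum]
  simp only [Finset.sum_comm (s := (Finset.univ : Finset Q))]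

theorem sum_sq_difference_le [LinearOrder A] [IsStrictOrderedRing A]
    (hτ : ∀ j k, Commute (τ j) (τ k)) (f : κ → Q → A) :
    ∑ j, ∑ k, ∑ q, (f j (τ k q) - f j q) ^ 2 ≤
      ∑ j, ∑ k, ∑ q, ((f j (τ k q) - f j q) + (f k (τ j q) - f k q)) ^ 2 := by
  have hcross : 0 ≤ ∑ j, ∑ k, ∑ q, (f j (τ k q) - f j q) * (f k (τ j q) - f k q) := by
    rw [sum_difference_mul_difference_eq_sum_sq hτ]
    positivity
  have hswap : ∑ j, ∑ k, ∑ q, (f k (τ j q) - f k q) ^ 2 =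
      ∑ j, ∑ k, ∑ q, (f j (τ k q) - f j q) ^ 2 := Finset.sum_comm
  have hnonneg : 0 ≤ ∑ j, ∑ k, ∑ q, (f j (τ k q) - f j q) ^ 2 := by positivity
  simp only [add_sq, Finset.sum_add_distrib, mul_assoc, ← Finset.mul_sum]
  linarith

end DiscreteDerivatives

section PeriodicDifferences

variable {ι κ Γ E : Type*} [Group Γ] [NormedAddCommGroup E] {t : κ → Γ}

theorem sum_isComplement_sq_difference_le [Fintype κ] {H : Subgroup Γ} {C : Finset Γ}
    (hC : IsComplement (C : Set Γ) (H : Set Γ)) (ht : ∀ j k, Commute (t j) (t k))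
    {F : κ → Γ → ℝ} (hF : ∀ j, PeriodicMod H (F j)) :
    ∑ j, ∑ k, ∑ c ∈ C, (F j (t k * c) - F j c) ^ 2 ≤
      ∑ j, ∑ k, ∑ c ∈ C, ((F j (t k * c) - F j c) + (F k (t j * c) - F k c)) ^ 2 := by
  have := finiteIndex_of_isComplement_finset hC
  have := Fintype.ofFinite (Γ ⧸ H)
  choose f hf using fun j => (hF j).exists_lift
  have h := sum_sq_difference_le (fun j k => (ht j k).map (MulAction.toPermHom Γ (Γ ⧸ H))) f
  simp only [← sum_isComplement_eq_sum_quotient hC] at h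
  simp only [← hf]
  exact h

variable {H : ι → Subgroup Γ} {e : ι → Γ → E}

theorem L2Dominated.difference_of_symmetric_difference [Finite κ] {F : κ → ι → Γ → ℝ}
    (hF : ∀ j i, PeriodicMod (H i) (F j i)) (ht : ∀ j k, Commute (t j) (t k))
    (h : ∀ j k, L2Dominated H e fun i g =>
      (F j i (t k * g) - F j i g) + (F k i (t j * g) - F k i g)) (j k : κ) :
    L2Dominated H e fun i g => F j i (t k * g) - F j i g := by
  have := Fintype.ofFinite κ
  choose K hK hsum using h
  refine ⟨∑ j, ∑ k, K j k, Finset.sum_nonneg fun j _ => Finset.sum_nonneg fun k _ => hK j k,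
    fun i C hC => ?_⟩
  simp only [Real.norm_eq_abs, sq_abs] at hsum ⊢
  calc ∑ c ∈ C, (F j i (t k * c) - F j i c) ^ 2
      ≤ ∑ j, ∑ k, ∑ c ∈ C, (F j i (t k * c) - F j i c) ^ 2 := by
        refine le_trans ?_ (Finset.single_le_sum (f := fun j => ∑ k, ∑ c ∈ C, _)
          (fun _ _ => by positivity) (Finset.mem_univ j))
        exact Finset.single_le_sum (f := fun k => ∑ c ∈ C, (F j i (t k * c) - F j i c) ^ 2)
          (fun _ _ => by positivity) (Finset.mem_univ k)
    _ ≤ ∑ j, ∑ k, ∑ c ∈ C, ((F j i (t k * c) - F j i c) + (F k i (t j * c) - F k i c)) ^ 2 :=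
        sum_isComplement_sq_difference_le hC ht fun j => hF j i
    _ ≤ ∑ j, ∑ k, K j k * ∑ c ∈ C, ‖e i c‖ ^ 2 := by
        gcongr with j _ k; exact hsum j k i C hC
    _ = _ := by simp only [Finset.sum_mul]

end PeriodicDifferences

section SkewApproximation

variable {V : Type*} [NormedAddCommGroup V] [InnerProductSpace ℝ V]

theorem inner_apply_add_inner_apply_of_mem_skewAdjoint [CompleteSpace V] {s : V →L[ℝ] V}
    (hs : s ∈ skewAdjoint (V →L[ℝ] V)) (x y : V) : ⟪x, s y⟫ + ⟪y, s x⟫ = 0 := by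
  have hs' : ContinuousLinearMap.adjoint s = -s := skewAdjoint.mem_iff.mp hs
  rw [← ContinuousLinearMap.adjoint_inner_left, hs', neg_apply, inner_neg_left,
    real_inner_comm, neg_add_cancel]

theorem L2Dominated.of_skewAdjoint_difference {ι κ Γ E : Type*} [Group Γ] [NormedAddCommGroup E]
    [Finite κ] [FiniteDimensional ℝ V] {H : ι → Subgroup Γ} {e : ι → Γ → E} {t : κ → Γ} {b : κ → V}
    {f : ι → Γ → V} {S : ι → Γ → V →L[ℝ] V} (ht : ∀ j k, Commute (t j) (t k))
    (hb : Submodule.span ℝ (Set.range b) = ⊤) (hf : ∀ i, PeriodicMod (H i) (f i))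
    (hS : ∀ i g, S i g ∈ skewAdjoint (V →L[ℝ] V))
    (h : ∀ k, L2Dominated H e fun i g => f i (t k * g) - f i g - S i g (b k)) :
    L2Dominated H e S := by
  have hinner (j k : κ) : L2Dominated H e fun i g => ⟪b j, f i (t k * g) - f i g - S i g (b k)⟫ :=
    (h k).of_norm_le fun i g => norm_inner_le_norm _ _
  have hsymm (j k : κ) : L2Dominated H e fun i g =>
      (⟪b j, f i (t k * g)⟫ - ⟪b j, f i g⟫) + (⟪b k, f i (t j * g)⟫ - ⟪b k, f i g⟫) := by
    convert (hinner j k).add (hinner k j) using 3 with i g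
    have := inner_apply_add_inner_apply_of_mem_skewAdjoint (hS i g) (b j) (b k)
    simp only [inner_sub_right]
    linarith
  have hdiff (k : κ) : L2Dominated H e fun i g => f i (t k * g) - f i g :=
    .of_inner_spanning hb fun j => by
      simpa only [inner_sub_right] using L2Dominated.difference_of_symmetric_difference
        (F := fun j i g => ⟪b j, f i g⟫) (fun j i => (hf i).comp _) ht hsymm j k
  exact .of_apply_spanning hb fun k => by
    simpa only [sub_sub_cancel] using (hdiff k).sub (h k)

end SkewApproximation

section Isometries

variable {d : ℕ}

theorem rot_mul (g h : Euc d) : rot (g * h) = rot g * rot h := rfl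

theorem rot_one_apply (x : Vec d) : rot (1 : Euc d) x = x := rfl

theorem apply_sub_apply (g : Euc d) (x y : Vec d) : g x - g y = rot g (x - y) :=
  (g.map_vsub x y).symm

theorem IsTranslation.apply {g : Euc d} (hg : IsTranslation g) (x : Vec d) :
    g x = x + transl g := by
  have h : g x - transl g = rot g (x - 0) := apply_sub_apply g x 0
  rw [hg, sub_zero, sub_eq_iff_eq_add] at h
  exact h

theorem isTranslation_of_forall_apply_eq_add {g : Euc d} {b : Vec d} (h : ∀ x, g x = x + b) :
    IsTranslation g := by
  refine LinearIsometryEquiv.ext fun x => ?_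
  rw [← sub_zero x, ← apply_sub_apply, h, h, add_sub_add_right_eq_sub]
  rfl

theorem IsTranslation.commute {g h : Euc d} (hg : IsTranslation g) (hh : IsTranslation h) :
    Commute g h := by
  refine AffineIsometryEquiv.ext fun x => ?_
  change g (h x) = h (g x)
  rw [hg.apply, hh.apply, hh.apply, hg.apply, add_right_comm]

theorem IsTranslation.pow {t : Euc d} (ht : IsTranslation t) (n : ℕ) : IsTranslation (t ^ n) := by
  induction n with
  | zero => rfl
  | succ n ih => rw [IsTranslation, pow_succ, rot_mul, ih, ht, one_mul]

/-- The linear span of the translation vectors of the translations in `G`. -/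
def translationSpan (G : Subgroup (Euc d)) : Submodule ℝ (Vec d) :=
  Submodule.span ℝ
    (Set.range fun t : {t : G // IsTranslation (t : Euc d)} => transl ((t : G) : Euc d))

theorem transl_mem_translationSpan {G : Subgroup (Euc d)} {t : G} (ht : IsTranslation (t : Euc d)) :
    transl (t : Euc d) ∈ translationSpan G :=
  Submodule.subset_span ⟨⟨t, ht⟩, rfl⟩

theorem IsSpaceGroup.translationSpan_eq_top {G : Subgroup (Euc d)} (hG : IsSpaceGroup G) :
    translationSpan G = ⊤ := by
  obtain ⟨t, ht, hlin⟩ := hG.translations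
  rw [eq_top_iff, ← hlin.span_eq_top_of_card_eq_finrank' (by simp), Submodule.span_le]
  rintro _ ⟨k, rfl⟩
  exact transl_mem_translationSpan (t := ⟨t k, (ht k).1⟩) (ht k).2

theorem exists_finite_translations {G : Subgroup (Euc d)} (hG : translationSpan G = ⊤) :
    ∃ (κ : Type) (_ : Finite κ) (t : κ → G), (∀ k, IsTranslation (t k : Euc d)) ∧
      Submodule.span ℝ (Set.range fun k => transl (t k : Euc d)) = ⊤ := by
  obtain ⟨κ, a, -, hspan, hlin⟩ := exists_linearIndependent' ℝ
    fun t : {t : G // IsTranslation (t : Euc d)} => transl ((t : G) : Euc d)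
  exact ⟨κ, hlin.finite, fun k => a k, fun k => (a k).2, hspan.trans hG⟩

end Isometries

section NormalForm

variable {d d₁ d₂ : ℕ} (hd : d₁ + d₂ = d)

theorem skewZero_le_skew : skewZero hd ≤ skew d := by
  rintro _ ⟨A, hA, rfl⟩
  have hA' : A.transpose = -A := hA
  change (matrixSum hd A 0).transpose = -matrixSum hd A 0
  rw [matrixSum, Matrix.transpose_reindex, Matrix.fromBlocks_transpose, hA']
  change _ = Matrix.reindex _ _ (-Matrix.fromBlocks A 0 0 0)
  rw [Matrix.fromBlocks_neg]
  simp only [Matrix.transpose_zero, neg_zero]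

theorem blockVec_castAdd (x : Vec d₁) (y : Vec d₂) (i : Fin d₁) :
    blockVec hd x y (Fin.cast hd (Fin.castAdd d₂ i)) = x i := by
  simp [blockVec]

theorem blockVec_surjective (z : Vec d) : ∃ x y, blockVec hd x y = z := by
  subst hd
  refine ⟨WithLp.toLp 2 fun i => z (Fin.castAdd d₂ i),
    WithLp.toLp 2 fun i => z (Fin.natAdd d₁ i), ?_⟩
  ext i
  refine Fin.addCases (fun i => ?_) (fun i => ?_) i <;> simp [blockVec]

theorem blockVec_add (x x' : Vec d₁) (y y' : Vec d₂) :
    blockVec hd (x + x') (y + y') = blockVec hd x y + blockVec hd x' y' := by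
  subst hd
  ext i
  refine Fin.addCases (fun i => ?_) (fun i => ?_) i <;> simp [blockVec]

theorem ProjectsTo.transl_eq {g : Euc d} {s : Euc d₂} (h : ProjectsTo hd g s) :
    transl g = blockVec hd 0 (transl s) := by
  obtain ⟨A, hA⟩ := h
  have h0 : blockVec hd 0 0 = 0 := by simpa using blockVec_add hd 0 0 0 0
  rw [transl, ← h0, hA, map_zero, transl]

theorem ProjectsTo.isTranslation {d : ℕ} {hd : 0 + d₂ = d} {g : Euc d} {s : Euc d₂}
    (h : ProjectsTo hd g s) (hs : IsTranslation s) : IsTranslation g := by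
  refine isTranslation_of_forall_apply_eq_add (b := blockVec hd 0 (transl s)) fun z => ?_
  obtain ⟨A, hA⟩ := h
  obtain ⟨x, y, rfl⟩ := blockVec_surjective hd z
  rw [hA, hs.apply, ← blockVec_add, Subsingleton.elim (A x) (x + 0)]

theorem eq_zero_of_forall_projectsTo {G : Subgroup (Euc d)} (hG : translationSpan G = ⊤)
    (hproj : ∀ g ∈ G, ∃ s, ProjectsTo hd g s) : d₁ = 0 := by
  by_contra hne
  let k : Fin d := Fin.cast hd (Fin.castAdd d₂ ⟨0, Nat.pos_of_ne_zero hne⟩)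
  have hle : translationSpan G ≤ LinearMap.ker (EuclideanSpace.proj (𝕜 := ℝ) k).toLinearMap := by
    refine Submodule.span_le.mpr ?_
    rintro _ ⟨t, rfl⟩
    obtain ⟨s, hs⟩ := hproj t t.1.2
    change transl ((t : G) : Euc d) k = 0
    rw [hs.transl_eq, blockVec_castAdd, PiLp.zero_apply]
  rw [hG] at hle
  simpa using hle (Submodule.mem_top (x := EuclideanSpace.single k (1 : ℝ)))

theorem IsTranslationSection.isTranslation {G : Subgroup (Euc d)} {S : Subgroup (Euc d₂)}
    {T : Set G} (hT : IsTranslationSection hd G S T) (hGS : IsNormalForm hd G S)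
    (hG : IsSpaceGroup G) {t : G} (ht : t ∈ T) : IsTranslation (t : Euc d) := by
  obtain rfl : d₁ = 0 := eq_zero_of_forall_projectsTo hd hG.translationSpan_eq_top fun g hg =>
    (hGS.mapsTo g hg).imp fun _ h => h.2
  obtain ⟨s, -, hs, hts⟩ := hT.mapsTo t ht
  exact hts.isTranslation hs

end NormalForm

section Patches

variable {d : ℕ} {G : Subgroup (Euc d)} {x₀ : Vec d} {R : Finset G}

theorem Property1.span_eq_top (hR : Property1 x₀ R) (hG : translationSpan G = ⊤) :
    Submodule.span ℝ (Set.range fun h : R => (h.1 : Euc d) x₀ - x₀) = ⊤ := by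
  have hmem : x₀ ∈ (fun g : G => (g : Euc d) x₀) '' (R : Set G) := ⟨1, hR.id_mem, rfl⟩
  have hvec : vectorSpan ℝ ((fun g : G => (g : Euc d) x₀) '' (R : Set G)) = ⊤ := by
    rw [← direction_affineSpan, hR.aff_eq, direction_affineSpan, eq_top_iff, ← hG]
    refine Submodule.span_le.mpr ?_
    rintro _ ⟨⟨t, ht⟩, rfl⟩
    change transl (t : Euc d) ∈ _
    rw [← add_sub_cancel_left x₀ (transl _), ← ht.apply]
    exact vsub_mem_vectorSpan ℝ ⟨t, rfl⟩ ⟨1, rfl⟩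
  rw [vectorSpan_eq_span_vsub_set_right ℝ hmem] at hvec
  rw [eq_top_iff, ← hvec]
  refine Submodule.span_mono ?_
  rintro _ ⟨_, ⟨g, hg, rfl⟩, rfl⟩
  exact ⟨⟨g, hg⟩, rfl⟩

theorem UrotOf_mono {W W' : Submodule ℝ (Matrix (Fin d) (Fin d) ℝ)} (h : W ≤ W') (x₀ : Vec d)
    (R : Finset G) : UrotOf W x₀ R ≤ UrotOf W' x₀ R :=
  fun _ ⟨A, hA, hu⟩ => ⟨A, h hA, hu⟩

theorem Uiso00_le_Uiso {d₁ d₂ : ℕ} (hd : d₁ + d₂ = d) (x₀ : Vec d) (R : Finset G) :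
    Uiso00 hd x₀ R ≤ Uiso x₀ R :=
  sup_le_sup_left (UrotOf_mono (skewZero_le_skew hd) x₀ R) _

theorem exists_rot_apply_eq_of_mem_Uiso {v : Disp R} (hv : v ∈ Uiso x₀ R) :
    ∃ a : Vec d, ∃ A ∈ skew d, ∀ h : R,
      rot (h.1 : Euc d) (v h) = a + Matrix.toEuclideanLin A ((h.1 : Euc d) x₀ - x₀) := by
  obtain ⟨v₁, ⟨a, ha⟩, v₂, ⟨A, hA, hv₂⟩, rfl⟩ := Submodule.mem_sup.mp hv
  exact ⟨a, A, hA, fun h => by rw [PiLp.add_apply, map_add, ha, hv₂]⟩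

theorem projKer_eq_sub (U : Submodule ℝ (Disp R)) (v : Disp R) :
    projKer U v = v - U.starProjection v :=
  U.starProjection_orthogonal_val v

theorem sub_projKer_mem (U : Submodule ℝ (Disp R)) (v : Disp R) : v - projKer U v ∈ U := by
  rw [projKer_eq_sub, sub_sub_cancel]
  exact U.starProjection_apply_mem v

theorem norm_projKer_le_norm_sub {U : Submodule ℝ (Disp R)} (v : Disp R) {w : Disp R}
    (hw : w ∈ U) : ‖projKer U v‖ ≤ ‖v - w‖ := by
  rw [projKer_eq_sub, U.starProjection_minimal]
  exact ciInf_le ⟨0, Set.forall_mem_range.mpr fun _ => norm_nonneg _⟩ (⟨w, hw⟩ : U)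

theorem norm_projKer_anti {U W : Submodule ℝ (Disp R)} (h : U ≤ W) (v : Disp R) :
    ‖projKer W v‖ ≤ ‖projKer U v‖ := by
  simpa only [sub_sub_cancel] using norm_projKer_le_norm_sub v (h (sub_projKer_mem U v))

theorem norm_projKer_patch_le_norm_nabla {U : Submodule ℝ (Disp R)} (hU : Utrans R ≤ U)
    (u : G → Vec d) (g : G) : ‖projKer U (patch R u g)‖ ≤ ‖nabla R u g‖ := by
  let w : Disp R := WithLp.toLp 2 fun h => (rot (h.1 : Euc d)).symm (u g)
  have hw : w ∈ Utrans R := ⟨u g, fun h => (rot (h.1 : Euc d)).apply_symm_apply (u g)⟩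
  have hsub : nabla R u g = patch R u g - w := by rw [nabla, patch, ← WithLp.toLp_sub]; rfl
  rw [hsub]
  exact norm_projKer_le_norm_sub (patch R u g) (hU hw)

/-- The displacement `u` in the fixed frame: the value at `g` is a vector at the point `g · x₀`. -/
noncomputable def labField (u : G → Vec d) (g : G) : Vec d := rot (g : Euc d) (u g)

theorem labField_mul (u : G → Vec d) (g h : G) :
    labField u (g * h) = rot (g : Euc d) (rot (h : Euc d) (u (g * h))) := rfl

theorem rot_mul_nabla_apply (u : G → Vec d) (g : G) (h : R) :
    rot ((g * h.1 : G) : Euc d) (nabla R u g h) = labField u (g * h.1) - labField u g := by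
  change rot (g : Euc d) (rot (h.1 : Euc d) (u (g * h.1) - (rot (h.1 : Euc d)).symm (u g))) = _
  rw [map_sub, LinearIsometryEquiv.apply_symm_apply, map_sub]
  rfl

theorem toEuclideanCLM_mem_skewAdjoint {A : Matrix (Fin d) (Fin d) ℝ} (hA : A ∈ skew d) :
    Matrix.toEuclideanCLM (𝕜 := ℝ) A ∈ skewAdjoint (Vec d →L[ℝ] Vec d) := by
  have hA' : star A = -A := (Matrix.conjTranspose_eq_transpose_of_trivial A).trans hA
  rw [skewAdjoint.mem_iff, ← map_star, hA', map_neg]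

theorem exists_skewAdjoint_norm_sub_le (x₀ : Vec d) (h1 : 1 ∈ R) (u : G → Vec d) (g : G) :
    ∃ s ∈ skewAdjoint (Vec d →L[ℝ] Vec d), ∀ h ∈ R,
      ‖labField u (g * h) - labField u g - s (rot (g : Euc d) ((h : Euc d) x₀ - x₀))‖ ≤
        2 * ‖projKer (Uiso x₀ R) (patch R u g)‖ := by
  set p := projKer (Uiso x₀ R) (patch R u g)
  obtain ⟨a, A, hA, hrigid⟩ := exists_rot_apply_eq_of_mem_Uiso (sub_projKer_mem _ (patch R u g))
  let q : Vec d →L[ℝ] Vec d := (rot (g : Euc d) : Vec d →L[ℝ] Vec d)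
  let s := q * Matrix.toEuclideanCLM (𝕜 := ℝ) A * star q
  have hs : ∀ x, s (rot (g : Euc d) x) = rot (g : Euc d) (Matrix.toEuclideanLin A x) := fun x => by
    change rot (g : Euc d) (Matrix.toEuclideanLin A (star q (q x))) = _
    have hq : star q = ((rot (g : Euc d)).symm : Vec d →L[ℝ] Vec d) :=
      LinearIsometryEquiv.star_eq_symm _
    rw [hq]
    exact congrArg _ (congrArg _ ((rot (g : Euc d)).symm_apply_apply x))
  have hlab : ∀ h : R, labField u (g * h.1) = rot (g : Euc d)
      (a + Matrix.toEuclideanLin A ((h.1 : Euc d) x₀ - x₀) + rot (h.1 : Euc d) (p h)) := fun h => by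
    have hh := hrigid h
    rw [PiLp.sub_apply, map_sub, sub_eq_iff_eq_add] at hh
    rw [labField_mul, ← hh]
    rfl
  refine ⟨s, skewAdjoint.conjugate (toEuclideanCLM_mem_skewAdjoint hA) q, fun h hh => ?_⟩
  have hres : labField u (g * h) - labField u g - s (rot (g : Euc d) ((h : Euc d) x₀ - x₀)) =
      rot (g : Euc d) (rot (h : Euc d) (p ⟨h, hh⟩)) - rot (g : Euc d) (p ⟨1, h1⟩) := by
    have hone : labField u g = rot (g : Euc d) (a + p ⟨1, h1⟩) := by
      simpa [rot_one_apply] using hlab ⟨1, h1⟩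
    rw [hlab ⟨h, hh⟩, hone, hs]
    simp only [map_add]
    abel
  have hh' := PiLp.norm_apply_le p ⟨h, hh⟩
  have h1' := PiLp.norm_apply_le p ⟨1, h1⟩
  rw [hres]
  refine (norm_sub_le _ _).trans ?_
  simp only [LinearIsometryEquiv.norm_map]
  linarith

end Patches

section Propagation

variable {d : ℕ} {G : Subgroup (Euc d)} {x₀ : Vec d}

/-- The error, at `g`, of approximating the increment of `f` along `w` by the linear map `S g`
applied to `g w · x₀ - g · x₀`. -/
noncomputable def residual (x₀ : Vec d) (f : G → Vec d) (S : G → Vec d →L[ℝ] Vec d) (w g : G) :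
    Vec d :=
  f (g * w) - f g - S g (rot (g : Euc d) ((w : Euc d) x₀ - x₀))

section Cocycle

variable {f : G → Vec d} {S : G → Vec d →L[ℝ] Vec d}

theorem residual_mul (v w g : G) :
    residual x₀ f S (v * w) g = residual x₀ f S w (g * v) + residual x₀ f S v g +
      (S (g * v) - S g) (rot ((g * v : G) : Euc d) ((w : Euc d) x₀ - x₀)) := by
  have hstep : rot (g : Euc d) (((v * w : G) : Euc d) x₀ - x₀) =
      rot ((g * v : G) : Euc d) ((w : Euc d) x₀ - x₀) +
        rot (g : Euc d) ((v : Euc d) x₀ - x₀) := by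
    change _ = rot (g : Euc d) (rot (v : Euc d) ((w : Euc d) x₀ - x₀)) + _
    rw [← map_add, ← apply_sub_apply (v : Euc d), sub_add_sub_cancel]
    rfl
  rw [residual, residual, residual, hstep, map_add, sub_apply, mul_assoc]
  abel

theorem residual_one (g : G) : residual x₀ f S 1 g = 0 := by
  simp [residual]

theorem residual_inv (w g : G) :
    residual x₀ f S w⁻¹ g = -(residual x₀ f S w (g * w⁻¹) +
      (S (g * w⁻¹) - S g) (rot ((g * w⁻¹ : G) : Euc d) ((w : Euc d) x₀ - x₀))) := by
  have h := residual_mul (x₀ := x₀) (f := f) (S := S) w⁻¹ w g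
  rw [inv_mul_cancel, residual_one, add_right_comm] at h
  exact (neg_eq_of_add_eq_zero_right h.symm).symm

theorem residual_conj_of_isTranslation {t : G} (ht : IsTranslation (t : Euc d)) (g : G) :
    residual x₀ f S (g⁻¹ * t * g) g = f (t * g) - f g - S g (transl (t : Euc d)) := by
  have hpath : g * (g⁻¹ * t * g) = t * g := by group
  have hstep : rot (g : Euc d) (((g⁻¹ * t * g : G) : Euc d) x₀ - x₀) = transl (t : Euc d) := by
    rw [← apply_sub_apply]
    change ((g * (g⁻¹ * t * g) : G) : Euc d) x₀ - _ = _
    rw [hpath]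
    change (t : Euc d) ((g : Euc d) x₀) - _ = _
    rw [ht.apply, add_sub_cancel_left]
  rw [residual, hpath, hstep]

end Cocycle

variable {ι E : Type*} [NormedAddCommGroup E] {H : ι → Subgroup G} {e : ι → G → E}
  {f : ι → G → Vec d} {S : ι → G → Vec d →L[ℝ] Vec d}

theorem L2Dominated.sub_of_residual (hH : ∀ i, (H i).Normal) (he : ∀ i, PeriodicMod (H i) (e i))
    {R : Finset G} {r : G}
    (hspan : Submodule.span ℝ (Set.range fun h : R => (h.1 : Euc d) x₀ - x₀) = ⊤)
    (hr : L2Dominated H e fun i g => residual x₀ (f i) (S i) r g)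
    (hR : ∀ h ∈ R, L2Dominated H e fun i g => residual x₀ (f i) (S i) h g)
    (hrR : ∀ h ∈ R, L2Dominated H e fun i g => residual x₀ (f i) (S i) (r * h) g) :
    L2Dominated H e fun i g => S i (g * r) - S i g := by
  have hcomp : L2Dominated H e fun i g => (S i (g * r) - S i g).comp
      (rot ((g * r : G) : Euc d) : Vec d →L[ℝ] Vec d) := by
    refine .of_apply_spanning hspan fun h => ?_
    have hcocycle : L2Dominated H e fun i g => residual x₀ (f i) (S i) (r * h.1) g -
        (residual x₀ (f i) (S i) h.1 (g * r) + residual x₀ (f i) (S i) r g) :=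
      (hrR h h.2).sub (((hR h h.2).shift hH he r).add hr)
    simp only [residual_mul, add_sub_cancel_left] at hcocycle
    exact hcocycle
  exact hcomp.of_norm_le (c := 1) fun i g => by
    rw [one_mul, ContinuousLinearMap.opNorm_comp_linearIsometryEquiv]

theorem L2Dominated.residual_of_closure_eq_top (hH : ∀ i, (H i).Normal)
    (he : ∀ i, PeriodicMod (H i) (e i)) {R' : Set G} (hR' : Subgroup.closure R' = ⊤)
    (hres : ∀ r ∈ R', L2Dominated H e fun i g => residual x₀ (f i) (S i) r g)
    (hslow : ∀ r ∈ R', L2Dominated H e fun i g => S i (g * r) - S i g) (w : G) :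
    L2Dominated H e fun i g => residual x₀ (f i) (S i) w g := by
  suffices h : L2Dominated H e (fun i g => residual x₀ (f i) (S i) w g) ∧
      L2Dominated H e fun i g => S i (g * w) - S i g from h.1
  have hw : w ∈ Subgroup.closure R' := hR' ▸ Subgroup.mem_top w
  induction hw using Subgroup.closure_induction with
  | mem r hr => exact ⟨hres r hr, hslow r hr⟩
  | one =>
    refine ⟨?_, ?_⟩
    · simpa only [residual_one] using .zero H e
    · simpa only [mul_one, sub_self] using .zero H e
  | mul v w _ _ hv hw =>
    refine ⟨?_, ?_⟩
    · simpa only [residual_mul] using ((hw.1.shift hH he v).add hv.1).add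
        (hv.2.apply fun i g => (LinearIsometryEquiv.norm_map _ _).le)
    · simpa only [mul_assoc, sub_add_sub_cancel] using (hw.2.shift hH he v).add hv.2
  | inv w _ hw =>
    have hslow' : L2Dominated H e fun i g => S i (g * w⁻¹) - S i g := by
      simpa only [inv_mul_cancel_right, neg_sub] using (hw.2.shift hH he w⁻¹).neg
    refine ⟨?_, hslow'⟩
    simpa only [residual_inv] using ((hw.1.shift hH he w⁻¹).add
      (hslow'.apply fun i g => (LinearIsometryEquiv.norm_map _ _).le)).neg

theorem L2Dominated.sub_apply_transl_of_residual (hH : ∀ i, ∀ s ∈ H i, IsTranslation (s : Euc d))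
    (hres : ∀ w, L2Dominated H e fun i g => residual x₀ (f i) (S i) w g) {t : G}
    (ht : IsTranslation (t : Euc d)) :
    L2Dominated H e fun i g => f i (t * g) - f i g - S i g (transl (t : Euc d)) := by
  refine .of_exists_finiteIndex fun ⟨i, _⟩ => ?_
  have hcent : H i ≤ Subgroup.centralizer {t} := fun s hs =>
    Subgroup.mem_centralizer_singleton_iff.mpr (Subtype.ext ((hH i s hs).commute ht))
  exact .of_forall_exists_eq (finite_range_conj_of_le_centralizer hcent) (fun w _ => hres w)
    fun j g => ⟨g⁻¹ * t * g, ⟨g, rfl⟩, (residual_conj_of_isTranslation ht g).symm⟩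

end Propagation

section Korn

variable {d : ℕ} {G : Subgroup (Euc d)} {x₀ : Vec d} {R : Finset G}

theorem PeriodicMod.patch {H : Subgroup G} (hH : H.Normal) {u : G → Vec d} (hu : PeriodicMod H u)
    (R : Finset G) : PeriodicMod H (patch R u) := fun g t ht => by
  refine congrArg (WithLp.toLp 2) (funext fun h => ?_)
  calc u (g * t * h.1) = u (g * h.1 * (h.1⁻¹ * t * h.1⁻¹⁻¹)) := by group
    _ = u (g * h.1) := hu _ _ (hH.conj_mem t ht h.1⁻¹)

theorem PeriodicMod.labField {H : Subgroup G} (hH : ∀ t ∈ H, IsTranslation (t : Euc d))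
    {u : G → Vec d} (hu : PeriodicMod H u) : PeriodicMod H (labField u) := fun g t ht => by
  rw [labField_mul, hu g t ht, hH t ht]
  rfl

theorem Property2.one_mem (hR : Property2 x₀ R) : 1 ∈ R := by
  obtain ⟨R', R'', h1, -, hR'', hsub⟩ := hR
  simpa using hsub (Set.mul_mem_mul h1 hR''.id_mem)

theorem L2Dominated.nabla_of_labField_sub {ι E : Type*} [NormedAddCommGroup E]
    {H : ι → Subgroup G} {e : ι → G → E} {u : ι → G → Vec d}
    (h : ∀ r ∈ R, L2Dominated H e fun i g => labField (u i) (g * r) - labField (u i) g) :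
    L2Dominated H e fun i => nabla R (u i) :=
  .of_separating (fun r => PiLp.proj 2 (fun _ : R => Vec d) r) (fun _ hv => PiLp.ext hv)
    fun r => (h r r.2).of_norm_le (c := 1) fun i g => by
      rw [one_mul, ← rot_mul_nabla_apply, LinearIsometryEquiv.norm_map]
      rfl

theorem L2Dominated.residual_of_property2 {ι E : Type*} [NormedAddCommGroup E]
    {H : ι → Subgroup G} {e : ι → G → E} {f : ι → G → Vec d} {S : ι → G → Vec d →L[ℝ] Vec d}
    (hG : translationSpan G = ⊤) (hR : Property2 x₀ R) (hH : ∀ i, (H i).Normal)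
    (he : ∀ i, PeriodicMod (H i) (e i))
    (hres : ∀ r ∈ R, L2Dominated H e fun i g => residual x₀ (f i) (S i) r g) (w : G) :
    L2Dominated H e fun i g => residual x₀ (f i) (S i) w g := by
  obtain ⟨R', R'', h1, hgen, hR'', hsub⟩ := hR
  have hmul : ∀ r ∈ R', ∀ h ∈ R'', r * h ∈ R := fun r hr h hh => hsub (Set.mul_mem_mul hr hh)
  have hleft : ∀ r ∈ R', r ∈ R := fun r hr => by simpa using hmul r hr 1 hR''.id_mem
  have hright : ∀ h ∈ R'', h ∈ R := fun h hh => by simpa using hmul 1 h1 h hh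
  refine .residual_of_closure_eq_top hH he hgen (fun r hr => hres r (hleft r hr))
    (fun r hr => ?_) w
  exact .sub_of_residual hH he (hR''.span_eq_top hG) (hres r (hleft r hr))
    (fun h hh => hres h (hright h hh)) fun h hh => hres _ (hmul r hr h hh)

theorem l2Dominated_projKer_patch_nabla {ι : Type*} {H : ι → Subgroup G} {u : ι → G → Vec d}
    (hG : translationSpan G = ⊤) (hR : Property2 x₀ R) (hH : ∀ i, (H i).Normal)
    (hHT : ∀ i, ∀ t ∈ H i, IsTranslation (t : Euc d)) (hu : ∀ i, PeriodicMod (H i) (u i)) :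
    L2Dominated H (fun i g => projKer (Uiso x₀ R) (patch R (u i) g)) fun i => nabla R (u i) := by
  set e : ι → G → Disp R := fun i g => projKer (Uiso x₀ R) (patch R (u i) g)
  have he (i : ι) : PeriodicMod (H i) (e i) := ((hu i).patch (hH i) R).comp _
  choose S hS happrox using fun i => exists_skewAdjoint_norm_sub_le x₀ hR.one_mem (u i)
  have hlocal : ∀ r ∈ R, L2Dominated H e fun i g => residual x₀ (labField (u i)) (S i) r g :=
    fun r hr => (L2Dominated.refl _ e).of_norm_le fun i g => happrox i g r hr
  have hglobal := L2Dominated.residual_of_property2 hG hR hH he hlocal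
  obtain ⟨κ, _, t, ht, hspan⟩ := exists_finite_translations hG
  have hskew : L2Dominated H e S :=
    .of_skewAdjoint_difference (fun j k => Subtype.ext ((ht j).commute (ht k))) hspan
      (fun i => (hu i).labField (hHT i)) hS fun k =>
      .sub_apply_transl_of_residual hHT hglobal (ht k)
  refine .nabla_of_labField_sub fun r hr => ?_
  have hrot : L2Dominated H e fun i g => S i g (rot (g : Euc d) ((r : Euc d) x₀ - x₀)) :=
    hskew.apply fun _ g => (LinearIsometryEquiv.norm_map (rot (g : Euc d)) _).le
  simpa only [residual, sub_add_cancel] using (hlocal r hr).add hrot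

end Korn

section SeminormEquivalence

variable {Γ V W : Type*} {C : Finset Γ}

theorem meanNorm_mono [SeminormedAddGroup V] [Norm W] {v : Γ → V} {w : Γ → W}
    (h : ∀ g, ‖v g‖ ≤ ‖w g‖) : meanNorm C v ≤ meanNorm C w := by
  unfold meanNorm
  gcongr with g
  exact h g

theorem meanNorm_le_mul_of_sum_sq_le [Norm V] [Norm W] {v : Γ → V} {w : Γ → W} {K : ℝ}
    (hK : 0 ≤ K) (h : ∑ c ∈ C, ‖v c‖ ^ 2 ≤ K * ∑ c ∈ C, ‖w c‖ ^ 2) :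
    meanNorm C v ≤ Real.sqrt K * meanNorm C w := by
  rw [meanNorm, meanNorm, ← Real.sqrt_mul hK, mul_left_comm]
  gcongr

variable {d : ℕ} {G : Subgroup (Euc d)} {x₀ : Vec d} {R : Finset G}

theorem rigidNorm_le_rigidNorm00 {d₁ d₂ : ℕ} (hd : d₁ + d₂ = d) (x₀ : Vec d) (R C : Finset G)
    (u : G → Vec d) : rigidNorm x₀ R C u ≤ rigidNorm00 hd x₀ R C u :=
  meanNorm_mono fun _ => norm_projKer_anti (Uiso00_le_Uiso hd x₀ R) _

theorem rigidNorm00_le_gradNorm {d₁ d₂ : ℕ} (hd : d₁ + d₂ = d) (x₀ : Vec d) (R C : Finset G)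
    (u : G → Vec d) : rigidNorm00 hd x₀ R C u ≤ gradNorm R C u :=
  meanNorm_mono fun g => norm_projKer_patch_le_norm_nabla le_sup_left u g

/-- A displacement with a normal subgroup of translations under which it is periodic. As the index
type in `L2Dominated`, it makes the constants uniform in the period and in the displacement. -/
structure PeriodicDisplacement (G : Subgroup (Euc d)) where
  lattice : Subgroup G
  normal : lattice.Normal
  isTranslation : ∀ t ∈ lattice, IsTranslation (t : Euc d)
  toFun : G → Vec d
  periodic : PeriodicMod lattice toFun

theorem exists_gradNorm_le_mul_rigidNorm (hG : translationSpan G = ⊤) (hR : Property2 x₀ R) :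
    ∃ K : ℝ, 0 < K ∧ ∀ (p : PeriodicDisplacement G) (C : Finset G),
      IsComplement (C : Set G) (p.lattice : Set G) →
        gradNorm R C p.toFun ≤ K * rigidNorm x₀ R C p.toFun := by
  obtain ⟨K, hK, hsum⟩ := l2Dominated_projKer_patch_nabla hG hR PeriodicDisplacement.normal
    PeriodicDisplacement.isTranslation PeriodicDisplacement.periodic
  refine ⟨Real.sqrt (K + 1), by positivity, fun p C hC => ?_⟩
  refine meanNorm_le_mul_of_sum_sq_le (by positivity) ((hsum p C hC).trans ?_)
  gcongr
  exact le_add_of_nonneg_right zero_le_one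

theorem IsRepresentationSet.isComplement [Group Γ] {T : Set Γ} {N : ℕ}
    (hC : IsRepresentationSet T N C) : IsComplement (C : Set Γ) (powSet T N) := by
  refine Subgroup.isComplement_iff_existsUnique_inv_mul_mem.mpr fun g => ?_
  obtain ⟨c, ⟨hc, t, ht, rfl⟩, huniq⟩ := hC g
  refine ⟨⟨c, hc⟩, by simpa using ht, fun c' hc' => Subtype.ext ?_⟩
  exact huniq c' ⟨c'.2, _, hc', (mul_inv_cancel_left _ _).symm⟩

end SeminormEquivalence

end DiscreteKorn

open DiscreteKorn in
theorem mainTheorem3_general {d d₁ d₂ : ℕ} (hd : d₁ + d₂ = d) {G : Subgroup (Euc d)}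
    (hG : translationSpan G = ⊤) (x₀ : Vec d) {R : Finset G} (hR : Property2 x₀ R) :
    ∃ c K : ℝ, 0 < c ∧ 0 < K ∧
      ∀ T : Set G, (∀ t ∈ T, IsTranslation (t : Euc d)) →
        ∀ N ∈ admissiblePeriods T, ∀ C : Finset G, IsRepresentationSet T N C →
          ∀ u : G → Vec d, IsPeriodic T N u →
            (c * rigidNorm00 hd x₀ R C u ≤ rigidNorm x₀ R C u ∧
              rigidNorm x₀ R C u ≤ K * rigidNorm00 hd x₀ R C u) ∧
            (c * gradNorm R C u ≤ rigidNorm x₀ R C u ∧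
              rigidNorm x₀ R C u ≤ K * gradNorm R C u) ∧
            (c * gradNorm R C u ≤ rigidNorm00 hd x₀ R C u ∧
              rigidNorm00 hd x₀ R C u ≤ K * gradNorm R C u) := by
  obtain ⟨K, hK, hkorn⟩ := exists_gradNorm_le_mul_rigidNorm hG hR
  refine ⟨K⁻¹, 1, inv_pos.mpr hK, one_pos, ?_⟩
  rintro T hT N ⟨-, H, hHnormal, hH⟩ C hC u hu
  have hHT : ∀ t ∈ H, IsTranslation (t : Euc d) := fun t ht => by
    obtain ⟨s, hs, rfl⟩ : t ∈ powSet T N := hH ▸ ht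
    exact (hT s hs).pow N
  have hper : PeriodicMod H u := fun g t ht => hu g t (hH ▸ ht)
  have hrigid := rigidNorm_le_rigidNorm00 hd x₀ R C u
  have hgrad := rigidNorm00_le_gradNorm hd x₀ R C u
  have hkorn' : K⁻¹ * gradNorm R C u ≤ rigidNorm x₀ R C u :=
    (inv_mul_le_iff₀ hK).mpr (hkorn ⟨H, hHnormal, hHT, u, hper⟩ C (hH ▸ hC.isComplement))
  have hgrad' : K⁻¹ * rigidNorm00 hd x₀ R C u ≤ K⁻¹ * gradNorm R C u := by gcongr
  simp only [one_mul]
  exact ⟨⟨hgrad'.trans hkorn', hrigid⟩, ⟨hkorn', hrigid.trans hgrad⟩, hkorn'.trans hrigid, hgrad⟩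

open DiscreteKorn in
/-- Discrete Korn inequality for space groups: on periodic displacements the seminorms `‖·‖_R`,
`‖·‖_{R,0,0}` and `‖∇_R ·‖₂` are equivalent, with constants that depend neither on the period `N`
nor on the representation set `C` of `G / T^N`. -/
theorem mainTheorem3 {d d₁ d₂ : ℕ} (hd : d₁ + d₂ = d)
    (G : Subgroup (Euc d)) (S : Subgroup (Euc d₂)) (hGS : IsNormalForm hd G S)
    (T : Set G) (hT : IsTranslationSection hd G S T)
    (hG : IsSpaceGroup G)
    (x₀ : Vec d) (hx₀ : Function.Injective fun g : G => (g : Euc d) x₀)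
    (R : Finset G) (hR : Property2 x₀ R) :
    ∃ c K : ℝ, 0 < c ∧ 0 < K ∧
      ∀ N ∈ admissiblePeriods T, ∀ C : Finset G, IsRepresentationSet T N C →
        ∀ u : G → Vec d, IsPeriodic T N u →
          (c * rigidNorm00 hd x₀ R C u ≤ rigidNorm x₀ R C u ∧
            rigidNorm x₀ R C u ≤ K * rigidNorm00 hd x₀ R C u) ∧
          (c * gradNorm R C u ≤ rigidNorm x₀ R C u ∧
            rigidNorm x₀ R C u ≤ K * gradNorm R C u) ∧
          (c * gradNorm R C u ≤ rigidNorm00 hd x₀ R C u ∧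
            rigidNorm00 hd x₀ R C u ≤ K * gradNorm R C u) := by
  obtain ⟨c, K, hc, hK, h⟩ := mainTheorem3_general hd hG.translationSpan_eq_top x₀ hR
  exact ⟨c, K, hc, hK, h T fun t ht => hT.isTranslation hd hGS hG ht⟩
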